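/- Let $H$ be a separable, infinite-dimensional complex Hilbert space and let $T$ be a bounded linear operator on $H$ with $\|T\|\le 1$. Put $D_T=(I-T^*T)^{1/2}$ and $D_{T^*}=(I-TT^*)^{1/2}$, and let $\mathcal D_T=\overline{D_TH}$ and $\mathcal D_{T^*}=\overline{D_{T^*}H}$ be the defect spaces of $T$. Assume that (i) $T$ is completely non-unitary, i.e. there is no non-zero closed subspace $M$ of $H$ that reduces $T$ (both $M$ and $M^\perp$ are invariant under $T$) and on which $T|_M$ is a unitary operator from $M$ onto $M$; (ii) $T$ is not an isometry; (iii) $\mathcal D_T\subseteq\mathcal D_{T^*}$ and $\dim\mathcal D_{T^*}<\infty$. Then $T$ is analytic, i.e. $\bigcap_{n\ge 1}T^nH=\{0\}$, if and only if $T$ has no non-zero eigenvalue. -/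

import Mathlib

open ContinuousLinearMap

noncomputable section

variable {H : Type*} [NormedAddCommGroup H] [InnerProductSpace ℂ H] [CompleteSpace H]

/-- The defect operator `D_T = (I - T* T)^{1/2}` (the positive square root) of a contraction `T`.
Applied to the adjoint of `T` it is `D_{T*} = (I - T T*)^{1/2}`. -/
def defectOperator (T : H →L[ℂ] H) : H →L[ℂ] H :=
  CFC.sqrt (1 - adjoint T ∘L T)

/-- The defect space of `T`: the closure of the range of the defect operator `D_T`. -/
def defectSpace (T : H →L[ℂ] H) : Submodule ℂ H :=
  (LinearMap.range (defectOperator T).toLinearMap).topologicalClosure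

/-- The subspace `M` reduces `T`: it is closed, and both `M` and its orthogonal complement
are invariant under `T`. -/
def IsReducingSubspace (T : H →L[ℂ] H) (M : Submodule ℂ H) : Prop :=
  IsClosed (M : Set H) ∧ (∀ x ∈ M, T x ∈ M) ∧ ∀ x ∈ Mᗮ, T x ∈ Mᗮ

/-- The restriction of `T` to `M` is a unitary operator on `M`: it is isometric on `M` and
maps `M` onto `M`. -/
def IsUnitaryOn (T : H →L[ℂ] H) (M : Submodule ℂ H) : Prop :=
  (∀ x ∈ M, ‖T x‖ = ‖x‖) ∧ M.map T.toLinearMap = M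

/-- `T` is a completely non-unitary contraction: `‖T‖ ≤ 1`, and no non-zero reducing subspace
`M` of `T` is such that `T` restricts to a unitary operator on `M`. -/
def IsCNUContraction (T : H →L[ℂ] H) : Prop :=
  ‖T‖ ≤ 1 ∧ ∀ M : Submodule ℂ H, IsReducingSubspace T M → IsUnitaryOn T M → M = ⊥

/-- `T` is analytic: the intersection of the ranges `T ^ n H` over `n ≥ 1` is `{0}`. -/
def IsAnalyticOperator (T : H →L[ℂ] H) : Prop :=
  (⋂ n : ℕ, ⋂ _ : 1 ≤ n, Set.range ⇑(T ^ n)) = ({0} : Set H)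

end

/-! Let `W` be the orthogonal complement of the defect space, that is, the set where `T* T x = x`.
The inclusion of defect spaces makes `W` invariant, so `T` is isometric on `W`; its unitary part
there, the intersection of the `T ^ n W`, reduces `T` and hence vanishes
(`iInf_map_pow_orthogonal_defectSpace`). The rest is linear algebra, because `W` has finite
codimension. The map induced on `H ⧸ W` has stabilizing kernels, so the core `R`, the intersection
of the `T ^ n H`, meets `W` only in 0 (`rangeCore_inf_le`) and is finite-dimensional. As `ker T` is
finite-dimensional too, `T` maps `R` onto `R`, hence bijectively; if `R` were non-zero, `T` would
have a non-zero eigenvalue on it (`rangeCore_eq_bot`). Conversely, an eigenvector for a non-zero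
eigenvalue lies in `R`. -/

section Algebra

variable {K V : Type*} [Field K] [AddCommGroup V] [Module K V]

/-- The intersection of the ranges of the powers of `f`. -/
def rangeCore (f : Module.End K V) : Submodule K V := ⨅ n : ℕ, LinearMap.range (f ^ n)

lemma mem_rangeCore {f : Module.End K V} {x : V} :
    x ∈ rangeCore f ↔ ∀ n : ℕ, ∃ y, (f ^ n) y = x := by
  simp [rangeCore]

lemma apply_mem_rangeCore {f : Module.End K V} {x : V} (hx : x ∈ rangeCore f) :
    f x ∈ rangeCore f := by
  rw [mem_rangeCore] at hx ⊢
  intro n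
  obtain ⟨y, rfl⟩ := hx n
  exact ⟨f y, by rw [← Module.End.mul_apply, ← Module.End.mul_apply, ← pow_succ, ← pow_succ']⟩

lemma range_pow_antitone (f : Module.End K V) :
    Antitone fun n : ℕ => LinearMap.range (f ^ n) := by
  refine antitone_nat_of_succ_le fun n => ?_
  rintro _ ⟨y, rfl⟩
  exact ⟨f y, by rw [← Module.End.mul_apply, ← pow_succ]⟩

/-- If the kernel of `f` is finite-dimensional, `f` maps the intersection of the ranges of its
powers onto itself. -/
lemma exists_mem_rangeCore_apply_eq (f : Module.End K V)
    [FiniteDimensional K (LinearMap.ker f)] {y : V} (hy : y ∈ rangeCore f) :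
    ∃ x ∈ rangeCore f, f x = y := by
  -- The decreasing chain `ker f ⊓ range (f ^ n)` stabilizes, say at `n₀`.
  let g : ℕ →o (Submodule K (LinearMap.ker f))ᵒᵈ :=
    ⟨fun n => OrderDual.toDual ((LinearMap.range (f ^ n)).comap (LinearMap.ker f).subtype),
      fun _ _ h => Submodule.comap_mono (range_pow_antitone f h)⟩
  obtain ⟨n₀, hn₀⟩ := IsArtinian.monotone_stabilizes g
  rw [mem_rangeCore] at hy
  obtain ⟨u, hu⟩ := hy (n₀ + 1)
  refine ⟨(f ^ n₀) u, ?_, by rw [← hu, pow_succ', Module.End.mul_apply]⟩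
  -- Two preimages of `y`, one in `range (f ^ n₀)` and one in `range (f ^ n)`, differ by an element
  -- of the stabilized kernel part, which lies in `range (f ^ n)`.
  have key : ∀ n, n₀ ≤ n → (f ^ n₀) u ∈ LinearMap.range (f ^ n) := by
    intro n hn
    obtain ⟨v, hv⟩ := hy (n + 1)
    have hker : (f ^ n₀) u - (f ^ n) v ∈ LinearMap.ker f := by
      rw [LinearMap.mem_ker, map_sub, ← Module.End.mul_apply, ← Module.End.mul_apply,
        ← pow_succ', ← pow_succ', hu, hv, sub_self]
    have h₀ : (⟨_, hker⟩ : LinearMap.ker f) ∈ OrderDual.ofDual (g n₀) :=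
      (LinearMap.range (f ^ n₀)).sub_mem ⟨u, rfl⟩ (range_pow_antitone f hn ⟨v, rfl⟩)
    rw [hn₀ n hn] at h₀
    have h₁ : (f ^ n₀) u - (f ^ n) v ∈ LinearMap.range (f ^ n) := h₀
    simpa using Submodule.add_mem _ h₁ (LinearMap.mem_range_self (f ^ n) v)
  rw [mem_rangeCore]
  intro n
  exact range_pow_antitone f (le_max_left n n₀) (key _ (le_max_right n n₀))

/-- Modulo an invariant subspace of finite codimension, the kernels of the powers stabilize. -/
lemma rangeCore_inf_le (f : Module.End K V) (W : Submodule K V) [FiniteDimensional K (V ⧸ W)]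
    (hW : ∀ x ∈ W, f x ∈ W) : rangeCore f ⊓ W ≤ ⨅ n : ℕ, W.map (f ^ n) := by
  rintro y ⟨hy, hyW⟩
  rw [Submodule.mem_iInf]
  intro n
  let k := Module.finrank K (V ⧸ W)
  -- The `k` extra powers absorb the quotient: the class of `x` is killed by `q ^ (n + k)`, hence
  -- already by `q ^ k`, so `(f ^ k) x ∈ W`.
  obtain ⟨x, hx⟩ := mem_rangeCore.1 hy (n + k)
  let q : Module.End K (V ⧸ W) := W.mapQ W f hW
  have hq : ∀ (m : ℕ) (z : V), (q ^ m) (W.mkQ z) = W.mkQ ((f ^ m) z) := by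
    intro m
    induction m with
    | zero => intro z; simp
    | succ m ih =>
      intro z
      rw [pow_succ, Module.End.mul_apply, pow_succ, Module.End.mul_apply, ← ih]
      rfl
  have h₁ : W.mkQ x ∈ LinearMap.ker (q ^ (n + k)) := by
    rw [LinearMap.mem_ker, hq, hx]
    simpa using hyW
  rw [Module.End.ker_pow_eq_ker_pow_finrank_of_le (Nat.le_add_left k n), LinearMap.mem_ker,
    hq] at h₁
  refine ⟨(f ^ k) x, by simpa using h₁, ?_⟩
  rw [← Module.End.mul_apply, ← pow_add, hx]

/-- A linear map that is injective on an invariant subspace `W` of finite codimension, and whose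
powers map `W` onto subspaces with zero intersection, has a non-zero eigenvalue unless the
intersection of the ranges of its powers is zero. -/
lemma rangeCore_eq_bot [IsAlgClosed K] (f : Module.End K V) (W : Submodule K V)
    [FiniteDimensional K (V ⧸ W)] (hW : ∀ x ∈ W, f x ∈ W) (hinj : ∀ x ∈ W, f x = 0 → x = 0)
    (hbot : ⨅ n : ℕ, W.map (f ^ n) = ⊥) (hev : ¬ ∃ μ : K, μ ≠ 0 ∧ f.HasEigenvalue μ) :
    rangeCore f = ⊥ := by
  -- A subspace meeting `W` trivially embeds in `V ⧸ W`.
  have fin : ∀ U : Submodule K V, U ⊓ W ≤ ⊥ → FiniteDimensional K U := by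
    intro U hU
    refine FiniteDimensional.of_injective (W.mkQ.comp U.subtype) ?_
    rw [injective_iff_map_eq_zero]
    intro x hx
    have : (x : V) ∈ W := by simpa using hx
    exact Subtype.ext ((Submodule.mem_bot K).1 (hU ⟨x.2, this⟩))
  have := fin (LinearMap.ker f) fun x hx => hinj x hx.2 hx.1
  have := fin (rangeCore f) ((rangeCore_inf_le f W hW).trans hbot.le)
  by_contra hne
  have := Submodule.nontrivial_iff_ne_bot.2 hne
  let g : Module.End K (rangeCore f) := f.restrict fun _ => apply_mem_rangeCore
  have hsurj : Function.Surjective g := by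
    rintro ⟨y, hy⟩
    obtain ⟨x, hx, hxy⟩ := exists_mem_rangeCore_apply_eq f hy
    exact ⟨⟨x, hx⟩, Subtype.ext hxy⟩
  have hg : Function.Injective g := LinearMap.injective_iff_surjective.2 hsurj
  obtain ⟨μ, hμ⟩ := Module.End.exists_eigenvalue g
  obtain ⟨v, hv⟩ := hμ.exists_hasEigenvector
  have hgv := hv.apply_eq_smul
  refine hev ⟨μ, ?_, Module.End.hasEigenvalue_of_hasEigenvector (x := (v : V)) ?_⟩
  · rintro rfl
    exact hv.2 (hg (by simpa using hgv))
  · rw [Module.End.hasEigenvector_iff, Module.End.mem_eigenspace_iff]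
    exact ⟨congrArg Subtype.val hgv, fun h => hv.2 (Subtype.ext h)⟩

/-- An eigenvector for a non-zero eigenvalue lies in the range of every power. -/
lemma mem_rangeCore_of_hasEigenvector {f : Module.End K V} {μ : K} (hμ : μ ≠ 0) {x : V}
    (hx : f.HasEigenvector μ x) : x ∈ rangeCore f := by
  rw [mem_rangeCore]
  intro n
  refine ⟨(μ ^ n)⁻¹ • x, ?_⟩
  rw [map_smul, hx.pow_apply, smul_smul, inv_mul_cancel₀ (pow_ne_zero n hμ), one_smul]

end Algebra

lemma isAnalyticOperator_iff_rangeCore_eq_bot {H : Type*} [NormedAddCommGroup H]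
    [InnerProductSpace ℂ H] (T : H →L[ℂ] H) :
    IsAnalyticOperator T ↔ rangeCore (T : H →ₗ[ℂ] H) = ⊥ := by
  have h : (⋂ n : ℕ, ⋂ _ : 1 ≤ n, Set.range ⇑(T ^ n)) =
      (rangeCore (T : H →ₗ[ℂ] H) : Set H) := by
    ext x
    rw [SetLike.mem_coe, mem_rangeCore]
    simp only [Set.mem_iInter, Set.mem_range, ← ContinuousLinearMap.toLinearMap_pow]
    refine ⟨fun h n => ?_, fun h n _ => h n⟩
    rcases Nat.eq_zero_or_pos n with rfl | hn
    · exact ⟨x, by simp⟩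
    · exact h n hn
  rw [IsAnalyticOperator, h, ← Submodule.bot_coe (R := ℂ), SetLike.coe_set_eq]

section Contraction

variable {H : Type*} [NormedAddCommGroup H] [InnerProductSpace ℂ H] [CompleteSpace H]

lemma one_sub_adjoint_comp_nonneg {T : H →L[ℂ] H} (hT : ‖T‖ ≤ 1) :
    0 ≤ 1 - adjoint T ∘L T := by
  have h : ‖star T * T‖ ≤ 1 := by
    rw [CStarRing.norm_star_mul_self]
    exact mul_le_one₀ hT (norm_nonneg _) hT
  exact sub_nonneg.2 ((CStarAlgebra.norm_le_one_iff_of_nonneg _ (star_mul_self_nonneg T)).1 h)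

/-- The orthogonal complement of the defect space is where `T* T` is the identity. -/
lemma mem_orthogonal_defectSpace {T : H →L[ℂ] H} (hT : ‖T‖ ≤ 1) {x : H} :
    x ∈ (defectSpace T)ᗮ ↔ adjoint T (T x) = x := by
  have hsq : defectOperator T * defectOperator T = 1 - adjoint T ∘L T :=
    CFC.sqrt_mul_sqrt_self _ (one_sub_adjoint_comp_nonneg hT)
  have hsa : adjoint (defectOperator T) = defectOperator T :=
    (IsSelfAdjoint.of_nonneg (CFC.sqrt_nonneg (1 - adjoint T ∘L T))).star_eq
  have hker : x ∈ (defectSpace T)ᗮ ↔ defectOperator T x = 0 := by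
    have h := ContinuousLinearMap.orthogonal_range (defectOperator T)
    rw [hsa] at h
    rw [defectSpace, Submodule.orthogonal_closure]
    exact (SetLike.ext_iff.1 h x).trans LinearMap.mem_ker
  have hx : defectOperator T (defectOperator T x) = x - adjoint T (T x) := by
    have := congrArg (fun A : H →L[ℂ] H => A x) hsq
    simpa using this
  rw [hker]
  constructor
  · intro h
    rw [h, map_zero] at hx
    exact (sub_eq_zero.1 hx.symm).symm
  · intro h
    rw [h, sub_self] at hx
    -- For the self-adjoint `D = D_T`, `⟪D x, D x⟫ = ⟪x, D (D x)⟫ = 0`.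
    rw [← inner_self_eq_zero (𝕜 := ℂ), ← ContinuousLinearMap.adjoint_inner_right, hsa, hx,
      inner_zero_right]

variable {T : H →L[ℂ] H}

/-- If `T* T x = x`, then `T T* (T x) = T x`, so `T x` is orthogonal to the defect space of `T*`,
and a fortiori to that of `T`. -/
lemma apply_mem_orthogonal_defectSpace (hT : ‖T‖ ≤ 1)
    (hsub : defectSpace T ≤ defectSpace (adjoint T)) {x : H} (hx : x ∈ (defectSpace T)ᗮ) :
    T x ∈ (defectSpace T)ᗮ := by
  have hT' : ‖adjoint T‖ ≤ 1 := by rwa [LinearIsometryEquiv.norm_map]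
  refine Submodule.orthogonal_le hsub ((mem_orthogonal_defectSpace hT').2 ?_)
  rw [adjoint_adjoint, (mem_orthogonal_defectSpace hT).1 hx]

lemma pow_apply_mem_orthogonal_defectSpace (hT : ‖T‖ ≤ 1)
    (hsub : defectSpace T ≤ defectSpace (adjoint T)) {x : H} (hx : x ∈ (defectSpace T)ᗮ)
    (n : ℕ) : (T ^ n) x ∈ (defectSpace T)ᗮ := by
  induction n with
  | zero => simpa using hx
  | succ n ih =>
    rw [pow_succ', mul_apply_eq_comp]
    exact apply_mem_orthogonal_defectSpace hT hsub ih

lemma norm_apply_of_mem_orthogonal_defectSpace (hT : ‖T‖ ≤ 1) {x : H}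
    (hx : x ∈ (defectSpace T)ᗮ) : ‖T x‖ = ‖x‖ := by
  have h : ‖T x‖ ^ 2 = ‖x‖ ^ 2 := by
    have := ContinuousLinearMap.apply_norm_sq_eq_inner_adjoint_left T x
    rw [ContinuousLinearMap.comp_apply, (mem_orthogonal_defectSpace hT).1 hx,
      inner_self_eq_norm_sq] at this
    exact this
  exact (sq_eq_sq₀ (norm_nonneg _) (norm_nonneg _)).1 h

lemma adjoint_pow_pow_apply_of_mem_orthogonal_defectSpace (hT : ‖T‖ ≤ 1)
    (hsub : defectSpace T ≤ defectSpace (adjoint T)) {x : H} (hx : x ∈ (defectSpace T)ᗮ)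
    (n : ℕ) : (adjoint T ^ n) ((T ^ n) x) = x := by
  induction n with
  | zero => simp
  | succ n ih =>
    rw [pow_succ, pow_succ', mul_apply_eq_comp, mul_apply_eq_comp,
      (mem_orthogonal_defectSpace hT).1 (pow_apply_mem_orthogonal_defectSpace hT hsub hx n), ih]

/-- If `D_T ⊆ D_{T*}`, the restriction of a completely non-unitary contraction `T` to the
orthogonal complement of its defect space is an isometry without unitary part. -/
lemma iInf_map_pow_orthogonal_defectSpace (hcnu : IsCNUContraction T)
    (hsub : defectSpace T ≤ defectSpace (adjoint T)) :
    ⨅ n : ℕ, (defectSpace T)ᗮ.map ((T : H →ₗ[ℂ] H) ^ n) = ⊥ := by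
  have hT := hcnu.1
  set W := (defectSpace T)ᗮ with hWdef
  set N := ⨅ n : ℕ, W.map ((T : H →ₗ[ℂ] H) ^ n) with hN
  have mem_N : ∀ {x}, x ∈ N ↔ ∀ n : ℕ, ∃ y ∈ W, (T ^ n) y = x := by
    intro x
    simp only [hN, Submodule.mem_iInf, Submodule.mem_map, ← ContinuousLinearMap.toLinearMap_pow]
    rfl
  have hNW : ∀ {x}, x ∈ N → x ∈ W := by
    intro x hx
    obtain ⟨y, hy, rfl⟩ := mem_N.1 hx 0
    simpa using hy
  have hTN : ∀ x ∈ N, T x ∈ N := by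
    intro x hx
    rw [mem_N] at hx ⊢
    intro n
    obtain ⟨y, hy, rfl⟩ := hx n
    refine ⟨T y, apply_mem_orthogonal_defectSpace hT hsub hy, ?_⟩
    rw [← mul_apply_eq_comp, ← mul_apply_eq_comp, ← pow_succ, ← pow_succ']
  -- On `N` the adjoint inverts `T`: if `x = T ^ (n + 1) z` with `z ∈ W`, then `T* x = T ^ n z`.
  have hback : ∀ x ∈ N, ∃ y ∈ N, T y = x ∧ adjoint T x = y := by
    intro x hx
    obtain ⟨y, hy, hyx⟩ := mem_N.1 hx 1
    rw [pow_one] at hyx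
    have hTx : adjoint T x = y := by rw [← hyx, (mem_orthogonal_defectSpace hT).1 hy]
    refine ⟨y, mem_N.2 fun n => ?_, hyx, hTx⟩
    obtain ⟨z, hz, hzx⟩ := mem_N.1 hx (n + 1)
    refine ⟨z, hz, ?_⟩
    rw [pow_succ', mul_apply_eq_comp] at hzx
    rw [← hTx, ← hzx, (mem_orthogonal_defectSpace hT).1
      (pow_apply_mem_orthogonal_defectSpace hT hsub hz n)]
  have hclosed : IsClosed (N : Set H) := by
    -- A preimage of `x` in `W` under `T ^ n` can only be `T* ^ n x`, which turns its existence into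
    -- closed conditions on `x`.
    have hset : (N : Set H) =
        ⋂ n : ℕ, ({x | (T ^ n) ((adjoint T ^ n) x) = x} ∩ (adjoint T ^ n) ⁻¹' (W : Set H)) := by
      ext x
      rw [SetLike.mem_coe, mem_N, Set.mem_iInter]
      refine forall_congr' fun n => ⟨?_, fun h => ⟨_, h.2, h.1⟩⟩
      rintro ⟨y, hy, rfl⟩
      have h := adjoint_pow_pow_apply_of_mem_orthogonal_defectSpace hT hsub hy n
      exact ⟨congrArg (T ^ n) h, by rw [Set.mem_preimage, h]; exact hy⟩
    rw [hset]
    refine isClosed_iInter fun n => IsClosed.inter ?_ ?_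
    · exact isClosed_eq (by fun_prop) continuous_id
    · exact (Submodule.isClosed_orthogonal _).preimage (ContinuousLinearMap.continuous _)
  refine hcnu.2 N ⟨hclosed, hTN, fun x hx => ?_⟩ ⟨fun x hx => ?_, ?_⟩
  -- The complement of `N` is `T`-invariant because `N` is `T*`-invariant.
  · rw [Submodule.mem_orthogonal] at hx ⊢
    intro u hu
    obtain ⟨y, hy, -, rfl⟩ := hback u hu
    rw [← ContinuousLinearMap.adjoint_inner_left]
    exact hx _ hy
  · exact norm_apply_of_mem_orthogonal_defectSpace hT (hNW hx)
  · refine le_antisymm ?_ fun x hx => ?_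
    · rintro _ ⟨x, hx, rfl⟩
      exact hTN x hx
    · obtain ⟨y, hy, hyx, -⟩ := hback x hx
      exact ⟨y, hy, hyx⟩

end Contraction

theorem mainTheorem2 {H : Type*} [NormedAddCommGroup H] [InnerProductSpace ℂ H]
    [CompleteSpace H] [TopologicalSpace.SeparableSpace H] (hdim : ¬ FiniteDimensional ℂ H)
    (T : H →L[ℂ] H) (hcnu : IsCNUContraction T) (hiso : ¬ Isometry T)
    (hsub : defectSpace T ≤ defectSpace (adjoint T))
    (hfin : FiniteDimensional ℂ (defectSpace (adjoint T))) :
    IsAnalyticOperator T ↔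
      ¬ ∃ μ : ℂ, μ ≠ 0 ∧ Module.End.HasEigenvalue (T : H →ₗ[ℂ] H) μ := by
  rw [isAnalyticOperator_iff_rangeCore_eq_bot]
  constructor
  · rintro h ⟨μ, hμ, hev⟩
    obtain ⟨v, hv⟩ := hev.exists_hasEigenvector
    have hmem := mem_rangeCore_of_hasEigenvector hμ hv
    rw [h, Submodule.mem_bot] at hmem
    exact hv.2 hmem
  · intro hev
    have : FiniteDimensional ℂ (defectSpace T) := Submodule.finiteDimensional_of_le hsub
    -- The quotient is isomorphic to the finite-dimensional defect space.
    have : FiniteDimensional ℂ (H ⧸ (defectSpace T)ᗮ) :=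
      (Submodule.quotientEquivOfIsCompl _ _
        (Submodule.isCompl_orthogonal
          (K := defectSpace T)).symm).symm.finiteDimensional
    refine rangeCore_eq_bot _ (defectSpace T)ᗮ
      (fun x hx => apply_mem_orthogonal_defectSpace hcnu.1 hsub hx) (fun x hx h0 => ?_)
      (iInf_map_pow_orthogonal_defectSpace hcnu hsub) hev
    have h0' : T x = 0 := h0
    rw [← (mem_orthogonal_defectSpace hcnu.1).1 hx, h0', map_zero]
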